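/- Convex allocation in dimension $\ell$ with weights $w_1,\dots,w_\ell>0$ is the following online problem. The state is a point of the simplex $\Delta^{\ell-1}=\{x\in[0,1]^\ell:\sum_i x_i=1\}$, initially a given point $x(0)$. At each time $t=1,2,\dots$ a direction $r_t\in\{1,\dots,\ell\}$ and a convex non-increasing function $f_t:[0,1]\to[0,\infty]$ are revealed; the algorithm then moves from $x(t-1)$ to some $x(t)\in\Delta^{\ell-1}$ and pays the movement cost $\sum_{i=1}^\ell w_i|x_i(t)-x_i(t-1)|$ plus the service cost $f_t(x_{r_t}(t))$. A deterministic online algorithm chooses $x(t)$ as a function of the requests up to and including time $t$. Theorem. There is an absolute constant $K$ such that for every $\ell\ge 2$ and all weights $w_1,\dots,w_\ell>0$ there is a constant $B$, depending only on $\ell$ and $w$, such that for every initial state $x(0)\in\Delta^{\ell-1}$ there is a deterministic online algorithm for convex allocation starting at $x(0)$ whose total cost on every finite request sequence is at most $K\log\ell\cdot\mathrm{OPT}+B$, where $\mathrm{OPT}$ is the infimum of the total costs, on the same request sequence, of all sequences of states in $\Delta^{\ell-1}$ starting at $x(0)$. That is, there is an $O(\log\ell)$-competitive online algorithm for convex allocation.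 -/

import Mathlib

open scoped NNReal ENNReal

noncomputable section

namespace ConvexAllocation

/-- A request of the convex allocation problem in dimension `ℓ`: a direction together with a cost
function `[0,1] → [0,∞]` that is non-increasing and convex (only the values on `[0,1]` matter; the
value `∞` is allowed, and convexity is meant in the extended sense). -/
structure Request (ℓ : ℕ) where
  dir : Fin ℓ
  cost : ℝ → ℝ≥0∞
  antitoneOn : AntitoneOn cost (Set.Icc 0 1)
  convexOn : ConvexOn ℝ≥0 (Set.Icc 0 1) cost

/-- The movement cost `∑ i, w i * |y i - x i|` in the weighted `ℓ₁` metric. -/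
def moveCost {ℓ : ℕ} (w : Fin ℓ → ℝ) (x y : stdSimplex ℝ (Fin ℓ)) : ℝ≥0∞ :=
  ENNReal.ofReal (∑ i, w i * |y.1 i - x.1 i|)

/-- The total cost of the trajectory `x 0, x 1, …` in the simplex on the request sequence `σ`.
When the `t`-th request (counted from `0`) arrives, the state moves from `x t` to `x (t + 1)`,
and the request is served in the new state `x (t + 1)`. -/
def totalCost {ℓ : ℕ} (w : Fin ℓ → ℝ) (σ : List (Request ℓ)) (x : ℕ → stdSimplex ℝ (Fin ℓ)) :
    ℝ≥0∞ :=
  ∑ t : Fin σ.length,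
    (moveCost w (x t) (x (t + 1)) + (σ.get t).cost ((x (t + 1)).1 (σ.get t).dir))

/-- The optimal offline cost: the infimum of the total costs of all trajectories from `x₀`. -/
def offlineCost {ℓ : ℕ} (w : Fin ℓ → ℝ) (x₀ : stdSimplex ℝ (Fin ℓ)) (σ : List (Request ℓ)) :
    ℝ≥0∞ :=
  ⨅ (y : ℕ → stdSimplex ℝ (Fin ℓ)) (_ : y 0 = x₀), totalCost w σ y

/-- A deterministic online algorithm: its state is a function of the requests revealed so far, the
current one included. Its initial state is the one for the empty list. -/
abbrev OnlineAlgorithm (ℓ : ℕ) : Type := List (Request ℓ) → stdSimplex ℝ (Fin ℓ)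

/-- The cost of an online algorithm on the request sequence `σ`. -/
def onlineCost {ℓ : ℕ} (w : Fin ℓ → ℝ) (A : OnlineAlgorithm ℓ) (σ : List (Request ℓ)) : ℝ≥0∞ :=
  totalCost w σ (fun t => A (σ.take t))

/-- The algorithm `A` has competitive ratio `ρ` with additive constant `B`: on every finite request
sequence its cost is at most `ρ` times the optimal offline cost from the same initial state,
plus `B`. -/
def IsCompetitive {ℓ : ℕ} (w : Fin ℓ → ℝ) (A : OnlineAlgorithm ℓ) (ρ B : ℝ≥0) : Prop :=
  ∀ σ : List (Request ℓ), onlineCost w A σ ≤ (ρ : ℝ≥0∞) * offlineCost w (A []) σ + (B : ℝ≥0∞)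

end ConvexAllocation

end

noncomputable section

namespace ConvexAllocation

open Set Filter Topology

/-! The proof is an amortized analysis with thresholds `s i ≥ x i`. Mass leaves coordinate `i` at
rate proportional to `(s i - x i + δ) / w i`, and only the requested coordinate `r` changes its
threshold. The potential compares the slack `s i - x i` with the offline slack `s i - y i` through a
relative entropy whose slope is truncated to `[-1, L]`, where `exp L = 18 ℓ`. The truncation makes
the potential `16 L`-Lipschitz in the offline state, which gives the `log ℓ`. It does no harm to the
online analysis, because the uniform part `δ` makes any capped coordinate outweigh all the others.

For a small multiple of a hinge cost vanishing at `x r + τ`, there are two cases. If the offline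
state is at least `τ / 2` ahead in `r`, the entropy of the donating coordinates drops enough to pay.
Otherwise the offline state itself pays a constant fraction of the hinge. This is
`exists_elementary_move`. Discrete moves suffice, with no differential equation, because convexity
bounds an increment by the derivative at its end point.

A general convex cost is a hinge locally, through its supporting line. `exists_serving_state`
accumulates elementary moves by a compactness argument that maximizes the fraction already served.
Extended-valued costs are first regularized, and the resulting defect is repaired by geometrically
small shifts of the played position. `potential_add_totalCost_le` sums over the requests. -/

/-- The perspective `b * H (a / b)` of `H u = u * log u - u + 1`, with the slope of `H` truncated to
`[-1, L]`, written as a Legendre transform. -/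
def clampedEntropy (L a b : ℝ) : ℝ :=
  sSup ((fun θ => θ * a - (Real.exp θ - 1) * b) '' Icc (-1) L)

/-! ### Truncated relative entropy -/

section clampedEntropy

variable {L : ℝ}

lemma le_clampedEntropy (a b : ℝ) {θ : ℝ} (hθ : θ ∈ Icc (-1) L) :
    θ * a - (Real.exp θ - 1) * b ≤ clampedEntropy L a b := by
  have hc : ContinuousOn (fun θ => θ * a - (Real.exp θ - 1) * b) (Icc (-1) L) := by fun_prop
  exact le_csSup (isCompact_Icc.image_of_continuousOn hc).bddAbove (mem_image_of_mem _ hθ)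

lemma exists_clampedEntropy_eq (hL : 0 ≤ L) (a b : ℝ) :
    ∃ θ ∈ Icc (-1) L, clampedEntropy L a b = θ * a - (Real.exp θ - 1) * b := by
  have hc : ContinuousOn (fun θ => θ * a - (Real.exp θ - 1) * b) (Icc (-1) L) := by fun_prop
  obtain ⟨θ, hθ, h⟩ := isCompact_Icc.exists_sSup_image_eq
    (nonempty_Icc.2 (by linarith : (-1 : ℝ) ≤ L)) hc
  exact ⟨θ, hθ, h⟩

lemma clampedEntropy_nonneg (hL : 0 ≤ L) (a b : ℝ) : 0 ≤ clampedEntropy L a b := by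
  have := le_clampedEntropy (L := L) a b (θ := 0) ⟨by norm_num, hL⟩
  simpa using this

lemma clampedEntropy_zero (hL : 0 ≤ L) : clampedEntropy L 0 0 = 0 := by
  obtain ⟨θ, -, h⟩ := exists_clampedEntropy_eq hL 0 0
  simpa using h

/-- The increment of the potential is bounded by its derivative at the end point, where the
maximizing slope satisfies the first order conditions. -/
lemma exists_clampedEntropy_sub_le (hL : 0 ≤ L) {a' b' : ℝ} (hb' : 0 ≤ b') :
    ∃ θ ∈ Icc (-1) L, (θ < L → a' ≤ Real.exp θ * b') ∧ (-1 < θ → Real.exp θ * b' ≤ a') ∧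
      ∀ a b, clampedEntropy L a' b' - clampedEntropy L a b
        ≤ θ * (a' - a) - (Real.exp θ - 1) * (b' - b) := by
  obtain ⟨θ, hθ, h⟩ := exists_clampedEntropy_eq hL a' b'
  refine ⟨θ, hθ, fun hlt => ?_, fun hlt => ?_, fun a b => ?_⟩
  -- Compare the maximizer with `θ + ε`, divide by `ε`, and let `ε → 0`. The lower condition is
  -- obtained in the same way from `θ - ε`.
  · have ht : Tendsto (fun ε : ℝ => Real.exp (θ + ε) * b') (𝓝[>] 0) (𝓝 (Real.exp θ * b')) := by
      have : Continuous (fun ε : ℝ => Real.exp (θ + ε) * b') := by fun_prop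
      simpa using (this.tendsto 0).mono_left nhdsWithin_le_nhds
    refine ge_of_tendsto ht ?_
    filter_upwards [Ioo_mem_nhdsGT (sub_pos.2 hlt)] with ε hε
    have h1 := le_clampedEntropy (L := L) a' b' (θ := θ + ε)
      ⟨by linarith [hθ.1, hε.1], by linarith [hε.2]⟩
    rw [h] at h1
    have h2 : Real.exp (θ + ε) - Real.exp θ ≤ ε * Real.exp (θ + ε) := by
      have h3 := Real.add_one_le_exp (-ε)
      have h4 : Real.exp θ = Real.exp (-ε) * Real.exp (θ + ε) := by
        rw [← Real.exp_add]; ring_nf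
      have := mul_le_mul_of_nonneg_right h3 (Real.exp_pos (θ + ε)).le
      linarith
    have h5 : ε * a' ≤ ε * (Real.exp (θ + ε) * b') := by
      have := mul_le_mul_of_nonneg_right h2 hb'
      linarith
    exact le_of_mul_le_mul_left h5 hε.1
  · have ht : Tendsto (fun ε : ℝ => Real.exp (θ - ε) * b') (𝓝[>] 0) (𝓝 (Real.exp θ * b')) := by
      have : Continuous (fun ε : ℝ => Real.exp (θ - ε) * b') := by fun_prop
      simpa using (this.tendsto 0).mono_left nhdsWithin_le_nhds
    refine le_of_tendsto ht ?_
    filter_upwards [Ioo_mem_nhdsGT (show (0 : ℝ) < θ + 1 by linarith)] with ε hε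
    have h1 := le_clampedEntropy (L := L) a' b' (θ := θ - ε)
      ⟨by linarith [hε.2], by linarith [hε.1, hθ.2]⟩
    rw [h] at h1
    have h2 : ε * Real.exp (θ - ε) ≤ Real.exp θ - Real.exp (θ - ε) := by
      have h3 := Real.add_one_le_exp ε
      have h4 : Real.exp θ = Real.exp ε * Real.exp (θ - ε) := by
        rw [← Real.exp_add]; ring_nf
      have := mul_le_mul_of_nonneg_right h3 (Real.exp_pos (θ - ε)).le
      linarith
    have h5 : ε * (Real.exp (θ - ε) * b') ≤ ε * a' := by
      have := mul_le_mul_of_nonneg_right h2 hb'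
      linarith
    exact le_of_mul_le_mul_left h5 hε.1
  -- The slope that is optimal at the end point is still admissible at the starting point.
  · have := le_clampedEntropy a b hθ
    rw [h]; linarith

/-- Admissible slopes are at most `L` in modulus in the first variable (`1 ≤ L` covers the slope
`-1`) and at most `exp L` in the second. Only the first bound enters the competitive ratio; the
second serves continuity. -/
lemma clampedEntropy_sub_le (hL : 1 ≤ L) (a b a' b' : ℝ) :
    clampedEntropy L a' b' - clampedEntropy L a b
      ≤ L * |a' - a| + Real.exp L * |b' - b| := by
  obtain ⟨θ, hθ, h⟩ := exists_clampedEntropy_eq (by linarith : 0 ≤ L) a' b'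
  have h1 := le_clampedEntropy a b hθ
  have h2 : θ * (a' - a) ≤ L * |a' - a| := by
    refine (le_abs_self _).trans ?_
    rw [abs_mul]
    exact mul_le_mul_of_nonneg_right (abs_le.2 ⟨by linarith [hθ.1], hθ.2⟩) (abs_nonneg _)
  have h3 : -((Real.exp θ - 1) * (b' - b)) ≤ Real.exp L * |b' - b| := by
    refine (neg_le_abs _).trans ?_
    rw [abs_mul]
    refine mul_le_mul_of_nonneg_right (abs_le.2 ⟨?_, ?_⟩) (abs_nonneg _)
    · linarith [Real.exp_pos θ, Real.add_one_le_exp L]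
    · linarith [Real.exp_le_exp.2 hθ.2]
  rw [h]; linarith

lemma continuous_clampedEntropy (hL : 1 ≤ L) :
    Continuous fun z : ℝ × ℝ => clampedEntropy L z.1 z.2 := by
  rw [continuous_iff_continuousAt]
  rintro ⟨a, b⟩
  rw [ContinuousAt, tendsto_iff_dist_tendsto_zero]
  have hc : Continuous fun z : ℝ × ℝ => L * |z.1 - a| + Real.exp L * |z.2 - b| := by fun_prop
  refine squeeze_zero (fun _ => dist_nonneg) (fun z => ?_) (by simpa using hc.tendsto (a, b))
  rw [Real.dist_eq, abs_le]
  have h1 := clampedEntropy_sub_le hL a b z.1 z.2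
  have h2 := clampedEntropy_sub_le hL z.1 z.2 a b
  rw [abs_sub_comm a, abs_sub_comm b] at h2
  exact ⟨by linarith, h1⟩

end clampedEntropy

/-! ### Potential and balance of an elementary move -/

section

variable {ι : Type*} [Fintype ι]

/-- The potential of the algorithm in state `x` with thresholds `s`, against the offline
state `y`. -/
def potential (L : ℝ) (w x s y : ι → ℝ) : ℝ :=
  16 * ∑ i, w i * (clampedEntropy L (s i - y i) (s i - x i) + (s i - x i) / 2)
    + 12 * ∑ i, w i * x i

/-- Total increment of the entropy terms over the coordinates that are decreased, at rate
`(b' i + δ) / w i`. -/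
lemma sum_entropy_sub_le {L : ℝ} (hL : 0 ≤ L) (A : Finset ι) (w a b b' : ι → ℝ)
    {lam δ τ d : ℝ} (hlam : 0 ≤ lam) (hδ : 0 ≤ δ)
    (hb' : ∀ i ∈ A, 0 ≤ b' i) (hw : ∀ i ∈ A, 0 ≤ w i)
    (hq : ∀ i ∈ A, w i * (b' i - b i) = lam * (b' i + δ))
    (hd : ∑ i ∈ A, (b' i - a i) ≤ -d)
    (hP : ∑ i ∈ A, (b' i + δ) ≤ Real.exp L * δ - τ) :
    ∑ i ∈ A, w i * (clampedEntropy L (a i) (b' i) - clampedEntropy L (a i) (b i))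
      ≤ lam * (A.card * δ - min d τ) := by
  classical
  have key : ∀ i, ∃ θ ∈ Icc (-1) L, i ∈ A → (θ < L → a i ≤ Real.exp θ * b' i) ∧
      w i * (clampedEntropy L (a i) (b' i) - clampedEntropy L (a i) (b i))
        ≤ lam * ((1 - Real.exp θ) * (b' i + δ)) := by
    intro i
    by_cases hi : i ∈ A
    · obtain ⟨θ, hθ, h1, -, h3⟩ := exists_clampedEntropy_sub_le hL (a' := a i) (hb' i hi)
      refine ⟨θ, hθ, fun _ => ⟨h1, ?_⟩⟩
      have h4 := mul_le_mul_of_nonneg_left (h3 (a i) (b i)) (hw i hi)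
      have h5 := hq i hi
      calc _ ≤ _ := h4
        _ = (1 - Real.exp θ) * (w i * (b' i - b i)) := by ring
        _ = _ := by rw [h5]; ring
    · exact ⟨0, ⟨by norm_num, hL⟩, fun h => absurd h hi⟩
  choose θ hθ h using key
  have hsum : ∑ i ∈ A, w i * (clampedEntropy L (a i) (b' i) - clampedEntropy L (a i) (b i))
      ≤ lam * ∑ i ∈ A, (1 - Real.exp (θ i)) * (b' i + δ) := by
    rw [Finset.mul_sum]
    exact Finset.sum_le_sum fun i hi => (h i hi).2
  refine hsum.trans (mul_le_mul_of_nonneg_left ?_ hlam)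
  -- Without capped slopes, `a i ≤ exp (θ i) * b' i` bounds each term by `b' i - a i + δ`. A single
  -- capped slope contributes `-exp L * δ`, which by `hP` leaves at most `-τ` in total.
  by_cases hall : ∀ i ∈ A, θ i < L
  · have h1 : ∑ i ∈ A, (1 - Real.exp (θ i)) * (b' i + δ) ≤ ∑ i ∈ A, ((b' i - a i) + δ) := by
      refine Finset.sum_le_sum fun i hi => ?_
      have := (h i hi).1 (hall i hi)
      have := mul_nonneg (Real.exp_pos (θ i)).le hδ
      linarith
    rw [Finset.sum_add_distrib, Finset.sum_const, nsmul_eq_mul] at h1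
    linarith [min_le_left d τ]
  · push Not at hall
    obtain ⟨j, hj, hjL⟩ := hall
    have hθj : θ j = L := le_antisymm (hθ j).2 hjL
    have h1 : ∑ i ∈ A, (1 - Real.exp (θ i)) * (b' i + δ)
        ≤ ∑ i ∈ A, ((b' i + δ) - if i = j then Real.exp L * δ else 0) := by
      refine Finset.sum_le_sum fun i hi => ?_
      split_ifs with hij
      · subst hij
        rw [hθj]
        have := mul_nonneg (Real.exp_pos L).le (hb' i hi)
        linarith
      · have := mul_nonneg (Real.exp_pos (θ i)).le (add_nonneg (hb' i hi) hδ)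
        linarith
    rw [Finset.sum_sub_distrib, Finset.sum_ite_eq' A j, if_pos hj] at h1
    have : 0 ≤ (A.card : ℝ) * δ := by positivity
    linarith [min_le_right d τ]

/-- Increment of the entropy term of the requested coordinate when its threshold is lowered. -/
lemma entropy_sub_le_of_lower {L a b v : ℝ} (hL : 0 ≤ L) (hv : 0 ≤ v) (hb : 0 < b)
    (hvb : 4 * v ≤ b) :
    clampedEntropy L (a - v) (b - 2 * v) - clampedEntropy L a b
      ≤ v * (4 * max 0 ((a - v) - (b - 2 * v)) / b) := by
  have hb' : 0 < b - 2 * v := by linarith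
  obtain ⟨θ, hθ, h1, h2, h3⟩ := exists_clampedEntropy_sub_le hL (a' := a - v) hb'.le
  have h4 := h3 a b
  have h5 : -θ + 2 * (Real.exp θ - 1) ≤ 4 * max 0 ((a - v) - (b - 2 * v)) / b := by
    rcases le_or_gt θ 0 with h0 | h0
    -- The convex function on the left lies below its chord on `[-1, 0]`, and it is nonpositive at
    -- both ends because `exp (-1) ≤ 1 / 2`. The lower truncation `-1` is needed here.
    · have : -θ + 2 * (Real.exp θ - 1) ≤ 0 := by
        have h6 : Real.exp (-1) ≤ 1 / 2 := by
          rw [Real.exp_neg, ← one_div]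
          exact one_div_le_one_div_of_le two_pos (by linarith [Real.add_one_le_exp 1])
        have h7 := convexOn_exp.2 (mem_univ (-1)) (mem_univ 0) (neg_nonneg.2 h0)
          (by linarith [hθ.1] : 0 ≤ 1 + θ) (by ring)
        simp only [smul_eq_mul, mul_zero, add_zero, Real.exp_zero, mul_one, mul_neg, neg_neg] at h7
        have h8 := mul_le_mul_of_nonneg_left h6 (neg_nonneg.2 h0)
        linarith
      refine this.trans ?_
      positivity
    · have h6 := h2 (by linarith)
      rw [le_div_iff₀ hb]
      have h7 : (Real.exp θ - 1) * (b - 2 * v) ≤ max 0 ((a - v) - (b - 2 * v)) := by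
        refine le_trans ?_ (le_max_right _ _)
        linarith
      have h8 : 0 ≤ Real.exp θ - 1 := by linarith [Real.add_one_le_exp θ]
      have h9 : (Real.exp θ - 1) * (b / 2) ≤ (Real.exp θ - 1) * (b - 2 * v) :=
        mul_le_mul_of_nonneg_left (by linarith) h8
      have h10 : 0 ≤ θ * b := by positivity
      linarith
  calc _ ≤ _ := h4
    _ = v * (-θ + 2 * (Real.exp θ - 1)) := by ring
    _ ≤ _ := mul_le_mul_of_nonneg_left h5 hv

/-- Increment of the entropy term of the requested coordinate when its threshold is raised. -/
lemma entropy_sub_le_of_raise {L a b v : ℝ} (hL : 0 ≤ L) (hv : 0 ≤ v) (hb : 0 ≤ b) :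
    clampedEntropy L (a + v) b - clampedEntropy L a b ≤ v * L ∧
      (a + v < 0 → clampedEntropy L (a + v) b - clampedEntropy L a b ≤ -v) := by
  obtain ⟨θ, hθ, h1, h2, h3⟩ := exists_clampedEntropy_sub_le hL (a' := a + v) hb
  have h4 : clampedEntropy L (a + v) b - clampedEntropy L a b ≤ v * θ := by
    have := h3 a b
    linarith
  refine ⟨h4.trans (mul_le_mul_of_nonneg_left hθ.2 hv), fun ha => ?_⟩
  have hθ1 : θ = -1 := by
    by_contra hne
    have := h2 (lt_of_le_of_ne hθ.1 (Ne.symm hne))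
    have := mul_nonneg (Real.exp_pos θ).le hb
    linarith
  rw [hθ1] at h4
  linarith

/-- The balance of an elementary move, when the threshold of the requested coordinate is
lowered. -/
lemma balance_lower {K lam τ d v V b P T R : ℝ} (hK : 64 ≤ K) (hlam : 0 ≤ lam) (hτ : 0 < τ)
    (hV : 0 ≤ V) (hP : 0 ≤ P) (hvτ : 12 * v ≤ τ) (hb : 0 < b) (hτb : τ ≤ 3 * b)
    (hT : T ≤ lam * ((P + τ) / 8 - min (d - v) τ))
    (hR : R ≤ V * (4 * max 0 (-(d - v)) / b)) :
    16 * (T + R + (-2 * V + lam * P) / 2) + 12 * (V - lam * P) + (V + lam * P)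
        + (lam + V / b) * τ
      ≤ K * (lam + V / b) * max 0 (τ - d) := by
  have hVb : 0 ≤ V / b := by positivity
  have hlP : 0 ≤ lam * P := by positivity
  have hlτ : 0 ≤ lam * τ := by positivity
  have h1 : V / b * τ ≤ 3 * V := by
    rw [div_mul_eq_mul_div, div_le_iff₀ hb]
    have := mul_le_mul_of_nonneg_left hτb hV
    linarith
  -- Here `d` is the offline lead in the requested coordinate. For `d ≥ τ / 2` the entropy drop pays
  -- for everything; otherwise the offline hinge cost is at least half of `τ`.
  rcases le_or_gt (τ / 2) d with h | h
  · have hm : τ / 3 ≤ min (d - v) τ := le_min (by linarith) (by linarith)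
    have hm' := mul_le_mul_of_nonneg_left hm hlam
    have h0 : max 0 (-(d - v)) = 0 := max_eq_left (by linarith)
    rw [h0] at hR
    have : 0 ≤ K * (lam + V / b) * max 0 (τ - d) := by positivity
    simp only [mul_zero, zero_div] at hR
    linarith
  · have he : max 0 (τ - d) = τ - d := max_eq_right (by linarith)
    rw [he]
    have hm : -(τ - d) ≤ min (d - v) τ := le_min (by linarith) (by linarith)
    have hm' := mul_le_mul_of_nonneg_left hm hlam
    have hle : max 0 (-(d - v)) ≤ τ - d := max_le (by linarith) (by linarith)
    have hR' : R ≤ 4 * (V / b) * (τ - d) := by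
      refine hR.trans ?_
      have : V * (4 * max 0 (-(d - v)) / b) = 4 * (V / b) * max 0 (-(d - v)) := by ring
      rw [this]
      gcongr
    have h2 : lam * τ ≤ lam * (2 * (τ - d)) := mul_le_mul_of_nonneg_left (by linarith) hlam
    have h3 : 64 * ((lam + V / b) * (τ - d)) ≤ K * ((lam + V / b) * (τ - d)) :=
      mul_le_mul_of_nonneg_right hK (mul_nonneg (by positivity) (by linarith))
    have h4 : 0 ≤ lam * (τ - d) := mul_nonneg hlam (by linarith)
    linarith

/-- The balance of an elementary move, when the threshold of the requested coordinate is
raised. -/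
lemma balance_raise {L K lam τ d v V P T R : ℝ} (hL : 3 ≤ L) (hK : 32 * L + 28 ≤ K)
    (hlam : 0 ≤ lam) (hτ : 0 < τ) (hV : 0 ≤ V) (hP : 0 ≤ P) (hvτ : 12 * v ≤ τ)
    (hT : T ≤ lam * ((P + τ) / 8 - min (d - v) τ))
    (hR : R ≤ V * L) (hR' : τ / 2 ≤ d → R ≤ -V) :
    16 * (T + R + (lam * P) / 2) + 12 * (V - lam * P) + (V + lam * P) + (lam + V / τ) * τ
      ≤ K * (lam + V / τ) * max 0 (τ - d) := by
  have hVb : 0 ≤ V / τ := by positivity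
  have hlP : 0 ≤ lam * P := by positivity
  have hlτ : 0 ≤ lam * τ := by positivity
  have h1 : V / τ * τ = V := div_mul_cancel₀ _ hτ.ne'
  rcases le_or_gt (τ / 2) d with h | h
  · have hm : τ / 3 ≤ min (d - v) τ := le_min (by linarith) (by linarith)
    have hm' := mul_le_mul_of_nonneg_left hm hlam
    have := hR' h
    have : 0 ≤ K * (lam + V / τ) * max 0 (τ - d) :=
      mul_nonneg (mul_nonneg (by linarith) (by positivity)) (le_max_left _ _)
    linarith
  · have he : max 0 (τ - d) = τ - d := max_eq_right (by linarith)
    rw [he]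
    have hm : -(τ - d) ≤ min (d - v) τ := le_min (by linarith) (by linarith)
    have hm' := mul_le_mul_of_nonneg_left hm hlam
    have h2 : lam * τ ≤ lam * (2 * (τ - d)) := mul_le_mul_of_nonneg_left (by linarith) hlam
    have h3 : (32 * L + 28) * ((lam + V / τ) * (τ - d)) ≤ K * ((lam + V / τ) * (τ - d)) :=
      mul_le_mul_of_nonneg_right hK (mul_nonneg (by positivity) (by linarith))
    have h4 : 0 ≤ lam * (τ - d) := mul_nonneg hlam (by linarith)
    -- Raising the threshold can cost `16 L V`, plus `14 V` for the other terms. Charging `V` to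
    -- twice the offline share yields exactly the requirement `32 L + 28 ≤ K`.
    have h5 : V ≤ 2 * (V / τ * (τ - d)) := by
      calc V = V / τ * τ := h1.symm
        _ ≤ V / τ * (2 * (τ - d)) := mul_le_mul_of_nonneg_left (by linarith) hVb
        _ = _ := by ring
    have h6 : (16 * L + 14) * V ≤ (16 * L + 14) * (2 * (V / τ * (τ - d))) :=
      mul_le_mul_of_nonneg_left h5 (by linarith)
    have h7 : 3 * (lam * (τ - d)) ≤ L * (lam * (τ - d)) := mul_le_mul_of_nonneg_right hL h4
    linarith

end

/-! ### Existence of elementary moves -/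

section

variable {ι : Type*} [Fintype ι]

/-- Moving the amounts `q i`, `i ∈ A`, to the coordinate `r`, and changing the threshold of `r` by
`t`: the effect on the potential and the movement cost. -/
lemma potential_move [DecidableEq ι] {L lam P v t : ℝ} {w x s y q : ι → ℝ} {r : ι} {A : Finset ι}
    (hrA : r ∉ A) (hq0 : ∀ i ∈ A, 0 ≤ q i) (hqA : ∀ i ∉ A, q i = 0)
    (hv : 0 ≤ v) (hP : ∑ i ∈ A, w i * q i = lam * P) :
    potential L w (fun i => if i = r then x r + v else x i - q i)
        (fun i => if i = r then s r + t else s i) y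
      + ∑ i, w i * |(if i = r then x r + v else x i - q i) - x i|
    = potential L w x s y
      + (16 * (∑ i ∈ A, w i * (clampedEntropy L (s i - y i) (s i - x i + q i)
            - clampedEntropy L (s i - y i) (s i - x i))
          + w r * (clampedEntropy L (s r - y r + t) (s r - x r + (t - v))
            - clampedEntropy L (s r - y r) (s r - x r))
          + (w r * (t - v) + lam * P) / 2) + 12 * (w r * v - lam * P) + (w r * v + lam * P)) := by
  have hdec : ∀ F : ι → ℝ, (∀ i ∉ A, i ≠ r → F i = 0) → ∑ i, F i = F r + ∑ i ∈ A, F i := by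
    intro F hF
    rw [← Finset.sum_insert hrA]
    refine (Finset.sum_subset (Finset.subset_univ _) fun i _ hi => ?_).symm
    rw [Finset.mem_insert, not_or] at hi
    exact hF i hi.2 hi.1
  have hne : ∀ i ∈ A, i ≠ r := fun i hi h => hrA (h ▸ hi)
  have h1 : ∑ i, w i * |(if i = r then x r + v else x i - q i) - x i| = w r * v + lam * P := by
    rw [hdec _ fun i hi hir => by simp [hir, hqA i hi], ← hP]
    congr 1
    · simp [abs_of_nonneg hv]
    · refine Finset.sum_congr rfl fun i hi => ?_
      simp [hne i hi, abs_of_nonneg (hq0 i hi)]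
  have h2 : ∑ i, w i * (if i = r then x r + v else x i - q i) - ∑ i, w i * x i
      = w r * v - lam * P := by
    rw [← Finset.sum_sub_distrib, hdec _ fun i hi hir => by simp [hir, hqA i hi], ← hP,
      sub_eq_add_neg (w r * v), ← Finset.sum_neg_distrib]
    congr 1
    · simp; ring
    · refine Finset.sum_congr rfl fun i hi => ?_
      simp only [hne i hi, if_false]; ring
  have h3 : ∑ i, w i * (clampedEntropy L ((if i = r then s r + t else s i) - y i)
          ((if i = r then s r + t else s i) - if i = r then x r + v else x i - q i)
          + ((if i = r then s r + t else s i) - if i = r then x r + v else x i - q i) / 2)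
        - ∑ i, w i * (clampedEntropy L (s i - y i) (s i - x i) + (s i - x i) / 2)
      = ∑ i ∈ A, w i * (clampedEntropy L (s i - y i) (s i - x i + q i)
            - clampedEntropy L (s i - y i) (s i - x i))
          + w r * (clampedEntropy L (s r - y r + t) (s r - x r + (t - v))
            - clampedEntropy L (s r - y r) (s r - x r))
          + (w r * (t - v) + lam * P) / 2 := by
    rw [← Finset.sum_sub_distrib, hdec _ fun i hi hir => by simp [hir, hqA i hi], ← hP]
    have h4 : ∀ i ∈ A, w i * (clampedEntropy L ((if i = r then s r + t else s i) - y i)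
          ((if i = r then s r + t else s i) - if i = r then x r + v else x i - q i)
          + ((if i = r then s r + t else s i) - if i = r then x r + v else x i - q i) / 2)
        - w i * (clampedEntropy L (s i - y i) (s i - x i) + (s i - x i) / 2)
        = w i * (clampedEntropy L (s i - y i) (s i - x i + q i)
            - clampedEntropy L (s i - y i) (s i - x i)) + w i * q i / 2 := by
      intro i hi
      simp only [hne i hi, if_false]
      rw [show s i - (x i - q i) = s i - x i + q i by ring]
      ring
    rw [Finset.sum_congr rfl h4, Finset.sum_add_distrib, ← Finset.sum_div]
    simp only [if_true]
    rw [show s r + t - y r = s r - y r + t by ring,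
      show s r + t - (x r + v) = s r - x r + (t - v) by ring]
    ring
  unfold potential
  linear_combination h1 + 12 * h2 + 16 * h3

/-- An elementary move towards the coordinate `r`, serving a small multiple `c` of the cost
function `z ↦ max 0 (x r + τ - z)`. -/
theorem exists_elementary_move {L K : ℝ} {w : ι → ℝ} (hw : ∀ i, 0 < w i)
    (hexp : Real.exp L = 18 * Fintype.card ι) (hL : 3 ≤ L) (hK : 32 * L + 28 ≤ K)
    {x s : ι → ℝ} (hx : x ∈ stdSimplex ℝ ι) (hs : ∀ i, x i ≤ s i) (r : ι) (hr : x r < 1)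
    {τ ε : ℝ} (hτ : 0 < τ) (hε : 0 < ε) :
    ∃ (x' s' : ι → ℝ) (c : ℝ), 0 < c ∧ c ≤ ε ∧ x' ∈ stdSimplex ℝ ι ∧ (∀ i, x' i ≤ s' i) ∧
      x r ≤ x' r ∧ (∀ i ≠ r, s' i = s i) ∧ s' r - x' r ≤ s r - x r ∧
      ∀ y ∈ stdSimplex ℝ ι, potential L w x' s' y + ∑ i, w i * |x' i - x i| + c * τ
        ≤ potential L w x s y + K * c * max 0 (τ - (y r - x r)) := by
  classical
  set A : Finset ι := Finset.univ.filter fun i => i ≠ r ∧ x i ≠ 0 with hA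
  have hrA : r ∉ A := by simp [hA]
  have hAx : ∀ i ∈ A, 0 < x i := fun i hi =>
    lt_of_le_of_ne (hx.1 i) (Ne.symm (Finset.mem_filter.1 hi).2.2)
  have hxA : ∀ i ∉ A, i ≠ r → x i = 0 := fun i hi hir => by
    by_contra h; exact hi (by simp [hA, hir, h])
  set E : ℝ := ∑ i ∈ A, (s i - x i) with hE
  have hE0 : 0 ≤ E := Finset.sum_nonneg fun i _ => sub_nonneg.2 (hs i)
  set n : ℝ := (Fintype.card ι : ℝ) with hn
  have hn0 : 0 < n := by
    have : Nonempty ι := ⟨r⟩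
    rw [hn]; exact_mod_cast Fintype.card_pos
  have hAn : (A.card : ℝ) ≤ n := by
    rw [hn]; exact_mod_cast Finset.card_le_univ A
  -- The uniform part costs at most `n δ = (E + τ) / 8` in the entropy estimate, while `exp L * δ =
  -- 18 n δ` still exceeds the total rate `P` by `τ`.
  set δ : ℝ := (E + τ) / (8 * n) with hδ
  have hδ0 : 0 < δ := by positivity
  have hnδ : 8 * (n * δ) = E + τ := by rw [hδ]; field_simp
  -- The threshold of `r` is lowered when its slack is at least `τ / 3`, and raised otherwise. In
  -- the second case an offline lead of `τ / 2` puts `y r` above the raised threshold, where the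
  -- entropy slope is `-1`.
  set ρ : ℝ := if τ ≤ 3 * (s r - x r) then s r - x r else τ with hρ
  have hρ0 : 0 < ρ := by
    rw [hρ]; split_ifs with h
    · linarith
    · exact hτ
  -- This solves `w i * q = lam * (s i - x i + q + δ)`: the rate is taken at the end of the move, to
  -- match the end-point derivative of the entropy.
  set Q : ℝ → ι → ℝ := fun lam i => lam * (s i - x i + δ) / (w i - lam) with hQ
  have hQt : ∀ i, Tendsto (fun lam => Q lam i) (𝓝[>] 0) (𝓝 0) := by
    intro i
    have : ContinuousAt (fun lam : ℝ => lam * (s i - x i + δ) / (w i - lam)) 0 := by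
      refine ContinuousAt.div (by fun_prop) (by fun_prop) ?_
      simpa using (hw i).ne'
    have h := this.tendsto
    simp only [zero_mul, zero_div] at h
    exact h.mono_left nhdsWithin_le_nhds
  have hVt : Tendsto (fun lam => ∑ i ∈ A, Q lam i) (𝓝[>] 0) (𝓝 0) := by
    simpa using tendsto_finsetSum A fun i _ => hQt i
  have hidt : Tendsto (fun lam : ℝ => lam) (𝓝[>] 0) (𝓝 0) :=
    tendsto_id.mono_left nhdsWithin_le_nhds
  have hct : Tendsto (fun lam => lam + w r * (∑ i ∈ A, Q lam i) / ρ) (𝓝[>] 0) (𝓝 0) := by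
    simpa using hidt.add ((hVt.const_mul (w r)).div_const ρ)
  have hev : ∀ᶠ lam in 𝓝[>] (0 : ℝ), 0 < lam ∧ (∀ i, lam < w i / 2) ∧ (∀ i ∈ A, Q lam i < x i) ∧
      ∑ i ∈ A, Q lam i < τ / 12 ∧ lam + w r * (∑ i ∈ A, Q lam i) / ρ < ε := by
    refine Filter.Eventually.and self_mem_nhdsWithin (Filter.Eventually.and ?_
      (Filter.Eventually.and ?_ (Filter.Eventually.and ?_ ?_)))
    · exact eventually_all.2 fun i => hidt.eventually_lt_const (half_pos (hw i))
    · exact (Filter.eventually_all_finset A).2 fun i hi => (hQt i).eventually_lt_const (hAx i hi)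
    · exact hVt.eventually_lt_const (by linarith)
    · exact hct.eventually_lt_const hε
  obtain ⟨lam, hlam, hlw, hQx, hQτ, hcε⟩ := hev.exists
  set q : ι → ℝ := fun i => if i ∈ A then Q lam i else 0 with hq
  have hqA : ∀ i ∉ A, q i = 0 := fun i hi => by simp [hq, hi]
  have hqQ : ∀ i ∈ A, q i = Q lam i := fun i hi => by simp [hq, hi]
  have hq0 : ∀ i, 0 ≤ q i := by
    intro i
    by_cases hi : i ∈ A
    · rw [hqQ i hi]
      exact div_nonneg (mul_nonneg hlam.le (by linarith [hs i])) (by linarith [hlw i, hw i])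
    · rw [hqA i hi]
  have hqx : ∀ i, q i ≤ x i := by
    intro i
    by_cases hi : i ∈ A
    · rw [hqQ i hi]; exact (hQx i hi).le
    · rw [hqA i hi]; exact hx.1 i
  have hwq : ∀ i ∈ A, w i * q i = lam * (s i - x i + q i + δ) := by
    intro i hi
    have hne : w i - lam ≠ 0 := by linarith [hlw i, hw i]
    have : q i * (w i - lam) = lam * (s i - x i + δ) := by
      rw [hqQ i hi, hQ]; exact div_mul_cancel₀ _ hne
    linarith
  set v : ℝ := ∑ i ∈ A, q i with hv
  have hvQ : ∑ i ∈ A, Q lam i = v := Finset.sum_congr rfl fun i hi => (hqQ i hi).symm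
  rw [hvQ] at hQτ hcε
  have hv0 : 0 ≤ v := Finset.sum_nonneg fun i _ => hq0 i
  set P : ℝ := ∑ i ∈ A, (s i - x i + q i + δ) with hP
  have hwP : ∑ i ∈ A, w i * q i = lam * P := by
    rw [hP, Finset.mul_sum]; exact Finset.sum_congr rfl hwq
  have hEP : E ≤ P := Finset.sum_le_sum fun i _ => by linarith [hq0 i]
  -- Since `lam < w i / 2`, end-point rates are at most twice the initial ones, so `P ≤ 2 (E + n
  -- δ)`.
  have hPN : P ≤ Real.exp L * δ - τ := by
    have h1 : P ≤ ∑ i ∈ A, 2 * ((s i - x i) + δ) := by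
      refine Finset.sum_le_sum fun i hi => ?_
      have h2 := hwq i hi
      have h3 : lam * (s i - x i + q i + δ) ≤ w i / 2 * (s i - x i + q i + δ) :=
        mul_le_mul_of_nonneg_right (hlw i).le (by linarith [hs i, hq0 i])
      have h4 : w i * q i ≤ w i * ((s i - x i + q i + δ) / 2) := by linarith
      have := le_of_mul_le_mul_left h4 (hw i)
      linarith
    rw [← Finset.mul_sum, Finset.sum_add_distrib, Finset.sum_const, nsmul_eq_mul] at h1
    have h2 := mul_le_mul_of_nonneg_right hAn hδ0.le
    rw [hexp]
    linarith
  have hkδ : (A.card : ℝ) * δ ≤ (P + τ) / 8 := by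
    have h2 := mul_le_mul_of_nonneg_right hAn hδ0.le
    linarith
  have hsplit : ∀ F : ι → ℝ, (∀ i ∉ A, i ≠ r → F i = 0) → ∑ i, F i = F r + ∑ i ∈ A, F i := by
    intro F hF
    rw [← Finset.sum_insert hrA]
    refine (Finset.sum_subset (Finset.subset_univ _) fun i _ hi => ?_).symm
    rw [Finset.mem_insert, not_or] at hi
    exact hF i hi.2 hi.1
  have hxsum : x r + ∑ i ∈ A, x i = 1 := by rw [← hsplit x hxA, hx.2]
  have hT : ∀ y ∈ stdSimplex ℝ ι, ∑ i ∈ A, w i * (clampedEntropy L (s i - y i) (s i - x i + q i)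
      - clampedEntropy L (s i - y i) (s i - x i))
      ≤ lam * ((P + τ) / 8 - min (y r - x r - v) τ) := by
    intro y hy
    have hy1 : y r + ∑ i ∈ A, y i ≤ 1 := by
      rw [← Finset.sum_insert hrA, ← hy.2]
      exact Finset.sum_le_sum_of_subset_of_nonneg (Finset.subset_univ _) fun i _ _ => hy.1 i
    refine (sum_entropy_sub_le (by linarith) A w (fun i => s i - y i) (fun i => s i - x i)
      (fun i => s i - x i + q i) (lam := lam) (δ := δ) (τ := τ) (d := y r - x r - v) hlam.le hδ0.le
      (fun i _ => by linarith [hs i, hq0 i]) (fun i _ => (hw i).le)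
      (fun i hi => by simpa using hwq i hi) ?_ hPN).trans ?_
    · have : ∑ i ∈ A, (s i - x i + q i - (s i - y i)) = ∑ i ∈ A, y i - ∑ i ∈ A, x i + v := by
        rw [hv, ← Finset.sum_sub_distrib, ← Finset.sum_add_distrib]
        exact Finset.sum_congr rfl fun i _ => by ring
      rw [this]; linarith
    · exact mul_le_mul_of_nonneg_left (by linarith) hlam.le
  have hP0 : 0 ≤ P := hE0.trans hEP
  have hV0 : 0 ≤ w r * v := mul_nonneg (hw r).le hv0
  have hsimp : (fun i => if i = r then x r + v else x i - q i) ∈ stdSimplex ℝ ι := by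
    refine ⟨fun i => ?_, ?_⟩
    · dsimp only
      split_ifs
      · linarith [hx.1 r]
      · linarith [hqx i]
    · rw [hsplit _ fun i hi hir => by simp [hir, hxA i hi hir, hqA i hi]]
      have : ∑ i ∈ A, (if i = r then x r + v else x i - q i) = ∑ i ∈ A, (x i - q i) :=
        Finset.sum_congr rfl fun i hi => by
          have hir : i ≠ r := by rintro rfl; exact hrA hi
          rw [if_neg hir]
      rw [this, Finset.sum_sub_distrib]
      simp only [if_true]
      linarith
  have hc0 : 0 < lam + w r * v / ρ := by positivity
  by_cases hcase : τ ≤ 3 * (s r - x r)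
  · have hρb : ρ = s r - x r := by rw [hρ, if_pos hcase]
    have hb : 0 < s r - x r := hρb ▸ hρ0
    refine ⟨fun i => if i = r then x r + v else x i - q i,
      fun i => if i = r then s r + -v else s i, lam + w r * v / ρ, hc0, hcε.le, hsimp, fun i => ?_,
      by simp [hv0], fun i hi => by simp [hi], by simp; linarith, fun y hy => ?_⟩
    · dsimp only
      split_ifs
      · linarith
      · linarith [hs i, hq0 i]
    · rw [potential_move hrA (fun i _ => hq0 i) hqA hv0 hwP]
      have hR := mul_le_mul_of_nonneg_left
        (entropy_sub_le_of_lower (L := L) (a := s r - y r) (b := s r - x r) (v := v)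
        (by linarith) hv0 hb (by linarith)) (hw r).le
      have hbal := balance_lower (K := K) (d := y r - x r) (v := v) (V := w r * v)
        (b := s r - x r) (by linarith) hlam.le hτ hV0 hP0 (by linarith) hb hcase (hT y hy)
        (hR.trans_eq (by
          rw [show s r - y r - v - (s r - x r - 2 * v) = -(y r - x r - v) by ring]; ring))
      rw [hρb, show s r - y r + -v = s r - y r - v by ring,
        show s r - x r + (-v - v) = s r - x r - 2 * v by ring,
        show w r * (-v - v) = -2 * (w r * v) by ring]
      linarith
  · have hρb : ρ = τ := by rw [hρ, if_neg hcase]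
    push Not at hcase
    refine ⟨fun i => if i = r then x r + v else x i - q i,
      fun i => if i = r then s r + v else s i, lam + w r * v / ρ, hc0, hcε.le, hsimp, fun i => ?_,
      by simp [hv0], fun i hi => by simp [hi], by simp, fun y hy => ?_⟩
    · dsimp only
      split_ifs
      · linarith [hs r]
      · linarith [hs i, hq0 i]
    · rw [potential_move hrA (fun i _ => hq0 i) hqA hv0 hwP]
      obtain ⟨hR1, hR2⟩ := entropy_sub_le_of_raise (L := L) (a := s r - y r) (b := s r - x r)
        (v := v) (by linarith) hv0 (sub_nonneg.2 (hs r))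
      have hR1' := mul_le_mul_of_nonneg_left hR1 (hw r).le
      have hbal := balance_raise (L := L) (K := K) (d := y r - x r) (v := v) (V := w r * v)
        hL hK hlam.le hτ hV0 hP0 (by linarith) (hT y hy) (hR1'.trans_eq (by ring))
        (fun hd => by
          have := mul_le_mul_of_nonneg_left (hR2 (by linarith)) (hw r).le
          linarith)
      rw [hρb, sub_self, add_zero, mul_zero, zero_add]
      linarith

end

/-! ### Regularization and supporting lines -/

/-- The infimal convolution of an allocation cost function with `k * max 0`: a real valued convex
minorant that nearly dominates the cost function. -/
lemma Request.exists_regularization {ℓ : ℕ} (q : Request ℓ) (hfin : q.cost 1 ≠ ⊤) {k : ℝ}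
    (hk : 0 ≤ k) :
    ∃ g : ℝ → ℝ, ConvexOn ℝ univ g ∧ Antitone g ∧ (∀ z, 0 ≤ g z) ∧
      (∀ z ∈ Icc (0 : ℝ) 1, ENNReal.ofReal (g z) ≤ q.cost z) ∧
      ∀ z ∈ Icc (0 : ℝ) 1, ∀ η, 0 ≤ η → g z < k * η →
        q.cost (min 1 (z + η)) ≤ ENNReal.ofReal (g z) := by
  let D := {y : ℝ // y ∈ Icc (0 : ℝ) 1 ∧ q.cost y ≠ ⊤}
  let F : ℝ → D → ℝ := fun z y => (q.cost y.1).toReal + k * max (y.1 - z) 0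
  let g : ℝ → ℝ := fun z => ⨅ y, F z y
  have : Nonempty D := ⟨⟨1, by simp, hfin⟩⟩
  have hF0 : ∀ z y, 0 ≤ F z y := fun z y =>
    add_nonneg ENNReal.toReal_nonneg (mul_nonneg hk (le_max_right _ _))
  have hbdd : ∀ z, BddBelow (range (F z)) := fun z => ⟨0, by rintro _ ⟨y, rfl⟩; exact hF0 z y⟩
  have hle : ∀ z y, g z ≤ F z y := fun z y => ciInf_le (hbdd z) y
  refine ⟨g, ⟨convex_univ, ?_⟩, ?_, fun z => le_ciInf (hF0 z), ?_, ?_⟩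
  · intro z₁ _ z₂ _ a b ha hb hab
    refine le_of_forall_pos_le_add fun ε hε => ?_
    obtain ⟨y₁, h₁⟩ := exists_lt_of_ciInf_lt (show g z₁ < g z₁ + ε by linarith)
    obtain ⟨y₂, h₂⟩ := exists_lt_of_ciInf_lt (show g z₂ < g z₂ + ε by linarith)
    have hmem : a * y₁.1 + b * y₂.1 ∈ Icc (0 : ℝ) 1 :=
      (convex_Icc (0 : ℝ) 1) y₁.2.1 y₂.2.1 ha hb hab
    have hc : q.cost (a * y₁.1 + b * y₂.1)
        ≤ ENNReal.ofReal a * q.cost y₁.1 + ENNReal.ofReal b * q.cost y₂.1 := by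
      have h : ∀ c d : ℝ≥0, c + d = 1 →
          q.cost (c * y₁.1 + d * y₂.1) ≤ c * q.cost y₁.1 + d * q.cost y₂.1 :=
        fun c d hcd => q.convexOn.2 y₁.2.1 y₂.2.1 zero_le zero_le hcd
      rw [ENNReal.ofReal_eq_coe_nnreal ha, ENNReal.ofReal_eq_coe_nnreal hb]
      exact h ⟨a, ha⟩ ⟨b, hb⟩ (NNReal.eq hab)
    have hf₁ : ENNReal.ofReal a * q.cost y₁.1 ≠ ⊤ :=
      ENNReal.mul_ne_top ENNReal.ofReal_ne_top y₁.2.2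
    have hf₂ : ENNReal.ofReal b * q.cost y₂.1 ≠ ⊤ :=
      ENNReal.mul_ne_top ENNReal.ofReal_ne_top y₂.2.2
    have hft := ENNReal.add_ne_top.2 ⟨hf₁, hf₂⟩
    have hc' := ENNReal.toReal_mono hft hc
    rw [ENNReal.toReal_add hf₁ hf₂, ENNReal.toReal_mul, ENNReal.toReal_mul,
      ENNReal.toReal_ofReal ha, ENNReal.toReal_ofReal hb] at hc'
    have h3 := hle (a • z₁ + b • z₂) ⟨a * y₁.1 + b * y₂.1, hmem, ne_top_of_le_ne_top hft hc⟩
    have h4 : max (a * y₁.1 + b * y₂.1 - (a * z₁ + b * z₂)) 0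
        ≤ a * max (y₁.1 - z₁) 0 + b * max (y₂.1 - z₂) 0 := by
      refine max_le ?_ (add_nonneg (mul_nonneg ha (le_max_right _ _))
        (mul_nonneg hb (le_max_right _ _)))
      have := mul_le_mul_of_nonneg_left (le_max_left (y₁.1 - z₁) 0) ha
      have := mul_le_mul_of_nonneg_left (le_max_left (y₂.1 - z₂) 0) hb
      linarith
    have h5 := mul_le_mul_of_nonneg_left h4 hk
    have h6 := mul_le_mul_of_nonneg_left h₁.le ha
    have h7 := mul_le_mul_of_nonneg_left h₂.le hb
    have h8 : a * ε + b * ε = ε := by rw [← add_mul, hab, one_mul]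
    simp only [smul_eq_mul, F] at *
    linarith
  · intro z₁ z₂ h
    refine ciInf_mono (hbdd z₂) fun y => ?_
    have : max (y.1 - z₂) 0 ≤ max (y.1 - z₁) 0 := max_le_max_right _ (by linarith)
    exact add_le_add_right (mul_le_mul_of_nonneg_left this hk) _
  · intro z hz
    by_cases h : q.cost z = ⊤
    · rw [h]; exact le_top
    · refine ENNReal.ofReal_le_of_le_toReal ((hle z ⟨z, hz, h⟩).trans_eq ?_)
      simp [F]
  · intro z hz η hη hlt
    -- A competitor with value below `k * η` lies to the left of `z + η`, so monotonicity applies.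
    have key : ∀ y : D, F z y < k * η → q.cost (min 1 (z + η)) ≤ q.cost y.1 := by
      intro y hy
      have h1 : k * (y.1 - z) < k * η := by
        have := mul_le_mul_of_nonneg_left (le_max_left (y.1 - z) 0) hk
        have : 0 ≤ (q.cost y.1).toReal := ENNReal.toReal_nonneg
        simp only [F] at hy
        linarith
      have h2 := lt_of_mul_lt_mul_left h1 hk
      exact q.antitoneOn y.2.1 ⟨le_min zero_le_one (by linarith [hz.1]), min_le_left _ _⟩
        (le_min y.2.1.2 (by linarith))
    have hval : ∀ y : D, (q.cost y.1).toReal ≤ F z y := fun y =>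
      le_add_of_nonneg_right (mul_nonneg hk (le_max_right _ _))
    obtain ⟨y₀, hy₀⟩ := exists_lt_of_ciInf_lt hlt
    have hfin' : q.cost (min 1 (z + η)) ≠ ⊤ := ne_top_of_le_ne_top y₀.2.2 (key y₀ hy₀)
    rw [← ENNReal.ofReal_toReal hfin']
    refine ENNReal.ofReal_le_ofReal (le_ciInf fun y => ?_)
    rcases lt_or_ge (F z y) (k * η) with h | h
    · exact (ENNReal.toReal_mono y.2.2 (key y h)).trans (hval y)
    · exact ((ENNReal.toReal_mono y₀.2.2 (key y₀ hy₀)).trans (hval y₀)).trans (hy₀.le.trans h)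

lemma exists_le_of_convexOn {g : ℝ → ℝ} (hg : ConvexOn ℝ univ g) (z : ℝ) :
    ∃ m : ℝ, ∀ y, g z + m * (y - z) ≤ g y := by
  have hz : z ∈ interior (univ : Set ℝ) := by simp
  refine ⟨derivWithin g (Ioi z) z, fun y => ?_⟩
  rcases lt_trichotomy y z with h | rfl | h
  · have h1 := (hg.slope_le_leftDeriv_of_mem_interior (mem_univ y) hz h).trans
      (hg.leftDeriv_le_rightDeriv_of_mem_interior hz)
    rw [slope_def_field, div_le_iff₀ (sub_pos.2 h)] at h1
    linarith
  · simp
  · have h1 := hg.rightDeriv_le_slope_of_mem_interior hz (mem_univ y) h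
    rw [slope_def_field, le_div_iff₀ (sub_pos.2 h)] at h1
    linarith

/-! ### Serving a real-valued convex cost -/

section

variable {ι : Type*} [Fintype ι]

lemma potential_nonneg {L : ℝ} (hL : 0 ≤ L) {w x s : ι → ℝ} (hw : ∀ i, 0 ≤ w i)
    (hx : ∀ i, 0 ≤ x i) (hs : ∀ i, x i ≤ s i) (y : ι → ℝ) : 0 ≤ potential L w x s y := by
  refine add_nonneg (mul_nonneg (by norm_num) (Finset.sum_nonneg fun i _ => mul_nonneg (hw i) ?_))
    (mul_nonneg (by norm_num) (Finset.sum_nonneg fun i _ => mul_nonneg (hw i) (hx i)))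
  exact add_nonneg (clampedEntropy_nonneg hL _ _) (by linarith [hs i])

/-- A convex non-increasing cost function on the coordinate `r` can be served at a cost which is
paid for by the potential and by any offline state. -/
theorem exists_serving_state {L K : ℝ} {w : ι → ℝ} (hw : ∀ i, 0 < w i)
    (hexp : Real.exp L = 18 * Fintype.card ι) (hL : 3 ≤ L) (hK : 32 * L + 28 ≤ K)
    {x s : ι → ℝ} (hx : x ∈ stdSimplex ℝ ι) (hs : ∀ i, x i ≤ s i) (r : ι) {g : ℝ → ℝ}
    (hconv : ConvexOn ℝ univ g) (hanti : Antitone g) (hg : ∀ z, 0 ≤ g z) :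
    ∃ x' s' : ι → ℝ, x' ∈ stdSimplex ℝ ι ∧ (∀ i, x' i ≤ s' i) ∧
      ∀ y ∈ stdSimplex ℝ ι, potential L w x' s' y + ∑ i, w i * |x' i - x i| + g (x' r)
        ≤ potential L w x s y + K * g (y r) := by
  have hgc : Continuous g := by
    rw [← continuousOn_univ]; exact hconv.continuousOn isOpen_univ
  have hle1 : ∀ x ∈ stdSimplex ℝ ι, ∀ i, x i ≤ 1 := fun x hx i =>
    hx.2 ▸ Finset.single_le_sum (fun i _ => hx.1 i) (Finset.mem_univ i)
  have hpc : ∀ y : ι → ℝ, Continuous fun p : (ι → ℝ) × (ι → ℝ) × ℝ => potential L w p.1 p.2.1 y := by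
    intro y
    unfold potential
    refine Continuous.add (continuous_const.mul (continuous_finsetSum _ fun i _ =>
      continuous_const.mul (Continuous.add ?_ (by fun_prop)))) (by fun_prop)
    exact (continuous_clampedEntropy (by linarith)).comp (by fun_prop : Continuous
      fun p : (ι → ℝ) × (ι → ℝ) × ℝ => (p.2.1 i - y i, p.2.1 i - p.1 i))
  -- The last component is the fraction of `g` already served within budget. The conditions on the
  -- thresholds keep `S` bounded.
  let S : Set ((ι → ℝ) × (ι → ℝ) × ℝ) := {p | p.1 ∈ stdSimplex ℝ ι ∧ (∀ i, p.1 i ≤ p.2.1 i) ∧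
    (∀ i, i ≠ r → p.2.1 i = s i) ∧ p.2.1 r - p.1 r ≤ s r - x r ∧ 0 ≤ p.2.2 ∧ p.2.2 ≤ 1 ∧
    ∀ y ∈ stdSimplex ℝ ι, potential L w p.1 p.2.1 y + ∑ i, w i * |p.1 i - x i| + p.2.2 * g (p.1 r)
        ≤ potential L w x s y + K * (p.2.2 * g (y r))}
  have hSclosed : IsClosed S := by
    simp only [S, ofPred_and, ofPred_forall]
    refine IsClosed.inter ((isClosed_stdSimplex ℝ ι).preimage continuous_fst) ?_
    refine IsClosed.inter (isClosed_iInter fun i => isClosed_le (by fun_prop) (by fun_prop)) ?_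
    refine IsClosed.inter (isClosed_iInter fun i => isClosed_iInter fun _ =>
      isClosed_eq (by fun_prop) (by fun_prop)) ?_
    refine IsClosed.inter (isClosed_le (by fun_prop) (by fun_prop)) ?_
    refine IsClosed.inter (isClosed_le (by fun_prop) (by fun_prop)) ?_
    refine IsClosed.inter (isClosed_le (by fun_prop) (by fun_prop)) ?_
    refine isClosed_iInter fun y => isClosed_iInter fun _ => isClosed_le ?_ (by fun_prop)
    exact ((hpc y).add (by fun_prop)).add (by fun_prop)
  have hScompact : IsCompact S := by
    refine (isCompact_Icc (a := ((0 : ι → ℝ), (0 : ι → ℝ), (0 : ℝ)))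
      (b := ((fun _ => 1 : ι → ℝ), (fun i => s i + 1 : ι → ℝ), (1 : ℝ)))).of_isClosed_subset
      hSclosed ?_
    rintro ⟨x', s', t⟩ ⟨h1, h2, h3, h4, h5, h6, -⟩
    refine ⟨⟨h1.1, fun i => (h1.1 i).trans (h2 i), h5⟩, fun i => hle1 x' h1 i, fun i => ?_, h6⟩
    by_cases hi : i = r
    · subst hi
      have := hle1 x' h1 i
      have := hx.1 i
      simp only at h4 ⊢
      linarith
    · have := h3 i hi
      simp only at this ⊢
      linarith
  have hSne : S.Nonempty := ⟨(x, s, 0), hx, hs, fun _ _ => rfl, le_rfl, le_rfl, zero_le_one,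
    fun y _ => by simp⟩
  obtain ⟨⟨x', s', t⟩, ⟨h1, h2, h3, h4, h5, h6, h7⟩, hmax⟩ :=
    hScompact.exists_isMaxOn hSne (f := fun p => p.2.2) (by fun_prop)
  simp only at h1 h2 h3 h4 h5 h6 h7
  have ht : t = 1 := by
    by_contra hne
    have ht1 : t < 1 := lt_of_le_of_ne h6 hne
    -- At a minimizer of `g` the remaining fraction could be served in place, because `1 ≤ K`.
    have hnot_min : ¬ ∀ y ∈ stdSimplex ℝ ι, g (x' r) ≤ g (y r) := by
      intro hmin
      have : ((x', s', 1) : (ι → ℝ) × (ι → ℝ) × ℝ) ∈ S := by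
        refine ⟨h1, h2, h3, h4, zero_le_one, le_rfl, fun y hy => ?_⟩
        have e1 := h7 y hy
        have e2 := mul_le_mul_of_nonneg_left (hmin y hy) (by linarith : 0 ≤ 1 - t)
        have e3 : 1 * ((1 - t) * g (y r)) ≤ K * ((1 - t) * g (y r)) :=
          mul_le_mul_of_nonneg_right (by linarith) (mul_nonneg (by linarith) (hg _))
        simp only
        linarith
      have := hmax this
      simp only [mem_ofPred_eq] at this
      linarith
    obtain ⟨m, hm⟩ : ∃ m, ∀ y, g (x' r) - m * (y - x' r) ≤ g y := by
      obtain ⟨m, hm⟩ := exists_le_of_convexOn hconv (x' r)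
      exact ⟨-m, fun y => by linarith [hm y]⟩
    have hx'1 : x' r < 1 := by
      refine lt_of_le_of_ne (hle1 x' h1 r) fun h => hnot_min fun y hy => hanti ?_
      rw [h]; exact hle1 y hy r
    have hm0 : 0 < m := by
      by_contra hm0
      push Not at hm0
      refine hnot_min fun y hy => ?_
      rcases le_total (y r) (x' r) with h | h
      · exact hanti h
      · have := hm (y r)
        have := mul_nonneg (neg_nonneg.2 hm0) (sub_nonneg.2 h)
        linarith
    have hgpos : 0 < g (x' r) := by
      refine lt_of_le_of_ne (hg _) fun h => hnot_min fun y hy => ?_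
      rw [← h]; exact hg _
    -- The supporting line of slope `-m` vanishes at distance `τ = g (x' r) / m`; the multiple `c =
    -- m * u` of the hinge serves a further fraction `u` of `g`.
    obtain ⟨x'', s'', c, hc0, hcε, k1, k2, k3, k4, k5, k6⟩ :=
      exists_elementary_move hw hexp hL hK h1 h2 r hx'1
        (τ := g (x' r) / m) (ε := m * (1 - t)) (div_pos hgpos (by linarith))
        (mul_pos (by linarith) (by linarith))
    obtain ⟨u, rfl⟩ : ∃ u, c = m * u := ⟨c / m, by field_simp⟩
    have hu0 : 0 < u := pos_of_mul_pos_right hc0 (by linarith)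
    have hu1 : u ≤ 1 - t := le_of_mul_le_mul_left hcε (by linarith)
    have : ((x'', s'', t + u) : (ι → ℝ) × (ι → ℝ) × ℝ) ∈ S := by
      refine ⟨k1, k2, fun i hi => (k4 i hi).trans (h3 i hi), k5.trans h4,
        by simp only; linarith, by simp only; linarith, fun y hy => ?_⟩
      simp only
      have e1 := k6 y hy
      have e2 := h7 y hy
      have e3 : m * u * (g (x' r) / m) = u * g (x' r) := by
        field_simp
      have e4 : m * u * max 0 (g (x' r) / m - (y r - x' r)) ≤ u * g (y r) := by
        rw [mul_assoc, mul_left_comm]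
        refine mul_le_mul_of_nonneg_left ?_ hu0.le
        rw [mul_max_of_nonneg _ _ (by linarith : 0 ≤ m), mul_zero]
        refine max_le (hg _) ?_
        have : m * (g (x' r) / m - (y r - x' r)) = g (x' r) - m * (y r - x' r) := by
          field_simp
        rw [this]; exact hm _
      have e5 : K * (m * u) * max 0 (g (x' r) / m - (y r - x' r)) ≤ K * (u * g (y r)) := by
        rw [mul_assoc]; exact mul_le_mul_of_nonneg_left e4 (by linarith)
      have e6 : ∑ i, w i * |x'' i - x i| ≤ ∑ i, w i * |x'' i - x' i| + ∑ i, w i * |x' i - x i| := by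
        rw [← Finset.sum_add_distrib]
        refine Finset.sum_le_sum fun i _ => ?_
        rw [← mul_add]
        exact mul_le_mul_of_nonneg_left (abs_sub_le _ _ _) (hw i).le
      -- Coordinate `r` never decreases, so the fraction served earlier is no more expensive at the
      -- new point.
      have e7 := mul_le_mul_of_nonneg_left (hanti k3) (by linarith : 0 ≤ t + u)
      rw [e3] at e1
      linarith
    have := hmax this
    simp only [mem_ofPred_eq] at this
    linarith
  subst ht
  exact ⟨x', s', h1, h2, fun y hy => by simpa using h7 y hy⟩

end

/-! ### Offline moves and position shifts -/

section

variable {ι : Type*} [Fintype ι]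

/-- The truncation at `L` bounds the price of an offline move by `16 L` times its length. -/
lemma potential_le_add {L : ℝ} (hL : 1 ≤ L) {w : ι → ℝ} (hw : ∀ i, 0 ≤ w i) (x s y y' : ι → ℝ) :
    potential L w x s y' ≤ potential L w x s y + 16 * L * ∑ i, w i * |y' i - y i| := by
  unfold potential
  have : ∑ i, w i * (clampedEntropy L (s i - y' i) (s i - x i) + (s i - x i) / 2)
      ≤ ∑ i, w i * (clampedEntropy L (s i - y i) (s i - x i) + (s i - x i) / 2)
        + L * ∑ i, w i * |y' i - y i| := by
    rw [Finset.mul_sum, ← Finset.sum_add_distrib]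
    refine Finset.sum_le_sum fun i _ => ?_
    have h := clampedEntropy_sub_le hL (s i - y i) (s i - x i) (s i - y' i) (s i - x i)
    rw [sub_self, abs_zero, mul_zero, add_zero, show s i - y' i - (s i - y i) = -(y' i - y i) by ring,
      abs_neg] at h
    have h' := mul_le_mul_of_nonneg_left h (hw i)
    linarith
  linarith

/-- Mass can be moved to the coordinate `r` until it reaches `min 1 (x r + η)`, changing no
coordinate by more than `η`. -/
lemma exists_shift [DecidableEq ι] {x : ι → ℝ} (hx : x ∈ stdSimplex ℝ ι) (r : ι) {η : ℝ}
    (hη : 0 ≤ η) :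
    ∃ p ∈ stdSimplex ℝ ι, p r = min 1 (x r + η) ∧ ∀ i, |p i - x i| ≤ η := by
  have hr1 : x r ≤ 1 := hx.2 ▸ Finset.single_le_sum (fun i _ => hx.1 i) (Finset.mem_univ r)
  rcases eq_or_lt_of_le hr1 with h | h
  · refine ⟨x, hx, ?_, fun i => by simpa using hη⟩
    rw [h, min_eq_left (by linarith)]
  · set κ : ℝ := (min 1 (x r + η) - x r) / (1 - x r) with hκ
    have hκ1 : κ * (1 - x r) = min 1 (x r + η) - x r := div_mul_cancel₀ _ (by linarith)
    have hm : x r ≤ min 1 (x r + η) := le_min hr1 (by linarith)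
    have hκ0 : 0 ≤ κ := div_nonneg (by linarith) (by linarith)
    have hκle : κ ≤ 1 := (div_le_one (by linarith)).2 (by linarith [min_le_left 1 (x r + η)])
    have hκη : κ * (1 - x r) ≤ η := by linarith [min_le_right 1 (x r + η)]
    refine ⟨(1 - κ) • x + κ • Pi.single r 1, convex_stdSimplex ℝ ι hx
      (single_mem_stdSimplex ℝ r) (by linarith) hκ0 (by ring), ?_, fun i => ?_⟩
    · simp only [Pi.add_apply, Pi.smul_apply, smul_eq_mul, Pi.single_eq_same]
      linarith
    · by_cases hi : i = r
      · subst hi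
        simp only [Pi.add_apply, Pi.smul_apply, smul_eq_mul, Pi.single_eq_same]
        rw [show (1 - κ) * x i + κ * 1 - x i = κ * (1 - x i) by ring,
          abs_of_nonneg (mul_nonneg hκ0 (by linarith))]
        exact hκη
      · simp only [Pi.add_apply, Pi.smul_apply, smul_eq_mul, Pi.single_eq_of_ne hi]
        rw [show (1 - κ) * x i + κ * 0 - x i = -(κ * x i) by ring, abs_neg,
          abs_of_nonneg (mul_nonneg hκ0 (hx.1 i))]
        have : x i + x r ≤ 1 := by
          rw [← Finset.sum_pair hi, ← hx.2]
          exact Finset.sum_le_sum_of_subset_of_nonneg (Finset.subset_univ _) fun i _ _ => hx.1 i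
        exact (mul_le_mul_of_nonneg_left (by linarith) hκ0).trans hκη

end

/-! ### Configurations and extended-valued requests -/

variable {ℓ : ℕ}

/-- The internal state of the algorithm (a point of the simplex and thresholds above its
coordinates), together with the position played. -/
structure Configuration (ℓ : ℕ) where
  point : Fin ℓ → ℝ
  threshold : Fin ℓ → ℝ
  position : stdSimplex ℝ (Fin ℓ)
  point_mem : point ∈ stdSimplex ℝ (Fin ℓ)
  point_le : ∀ i, point i ≤ threshold i

/-- The potential of a configuration against an offline state. -/
def Configuration.potential (L : ℝ) (w : Fin ℓ → ℝ) (C : Configuration ℓ)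
    (y : stdSimplex ℝ (Fin ℓ)) : ℝ :=
  ConvexAllocation.potential L w C.point C.threshold y.1

lemma Configuration.potential_nonneg {L : ℝ} (hL : 0 ≤ L) {w : Fin ℓ → ℝ} (hw : ∀ i, 0 ≤ w i)
    (C : Configuration ℓ) (y : stdSimplex ℝ (Fin ℓ)) : 0 ≤ C.potential L w y :=
  ConvexAllocation.potential_nonneg hL hw C.point_mem.1 C.point_le _

/-- `C'` serves the request `q` from `C`: its position is within `η` of its point, and the movement
of the point and the service cost are paid for by the potential and any offline state. -/
def Serves (L K : ℝ) (w : Fin ℓ → ℝ) (η : ℝ) (C : Configuration ℓ) (q : Request ℓ)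
    (C' : Configuration ℓ) : Prop :=
  (∀ i, |C'.position.1 i - C'.point i| ≤ η) ∧ ∀ y : stdSimplex ℝ (Fin ℓ),
    ENNReal.ofReal (C'.potential L w y) + ENNReal.ofReal (∑ i, w i * |C'.point i - C.point i|)
      + q.cost (C'.position.1 q.dir)
    ≤ ENNReal.ofReal (C.potential L w y) + ENNReal.ofReal K * q.cost (y.1 q.dir)

theorem exists_serves {L K : ℝ} {w : Fin ℓ → ℝ} (hw : ∀ i, 0 < w i)
    (hexp : Real.exp L = 18 * ℓ) (hL : 3 ≤ L) (hK : 32 * L + 28 ≤ K) {η : ℝ} (hη : 0 < η)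
    (C : Configuration ℓ) (q : Request ℓ) : ∃ C', Serves L K w η C q C' := by
  have hK0 : 0 < K := by linarith
  have hIcc : ∀ y ∈ stdSimplex ℝ (Fin ℓ), ∀ i, y i ∈ Icc (0 : ℝ) 1 := fun y hy i =>
    ⟨hy.1 i, hy.2 ▸ Finset.single_le_sum (fun i _ => hy.1 i) (Finset.mem_univ i)⟩
  have h1mem : (1 : ℝ) ∈ Icc (0 : ℝ) 1 := ⟨zero_le_one, le_rfl⟩
  -- In this case every offline state pays `⊤`, and standing still is good enough.
  by_cases hfin : q.cost 1 = ⊤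
  · refine ⟨⟨C.point, C.threshold, ⟨C.point, C.point_mem⟩, C.point_mem, C.point_le⟩,
      fun i => by simpa using hη.le, fun y => ?_⟩
    have hy := hIcc y.1 y.2 q.dir
    have : q.cost (y.1 q.dir) = ⊤ := top_unique (hfin ▸ q.antitoneOn hy h1mem hy.2)
    rw [this, ENNReal.mul_top (by simpa using hK0), add_top]
    exact le_top
  · set e : stdSimplex ℝ (Fin ℓ) := ⟨Pi.single q.dir 1, single_mem_stdSimplex ℝ q.dir⟩ with he
    have hw' : ∀ i, 0 ≤ w i := fun i => (hw i).le
    -- Comparison with the vertex `e` bounds the regularized service cost by `Q` in advance. The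
    -- slope `(Q + 1) / η` is therefore steep enough for a shift by `η` to recover the true cost.
    set Q : ℝ := C.potential L w e + K * (q.cost 1).toReal with hQ
    have hQ0 : 0 ≤ Q := add_nonneg (C.potential_nonneg (by linarith) hw' e)
      (mul_nonneg hK0.le ENNReal.toReal_nonneg)
    obtain ⟨g, hconv, hanti, hg0, hgle, hgk⟩ :=
      q.exists_regularization hfin (k := (Q + 1) / η) (by positivity)
    obtain ⟨x', s', hx', hs', h⟩ := exists_serving_state hw (by simpa using hexp) hL hK C.point_mem
      C.point_le q.dir hconv hanti hg0
    obtain ⟨p, hp, hpr, hpη⟩ := exists_shift hx' q.dir hη.le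
    have hmv : 0 ≤ ∑ i, w i * |x' i - C.point i| :=
      Finset.sum_nonneg fun i _ => mul_nonneg (hw' i) (abs_nonneg _)
    have hpot : ∀ y, 0 ≤ ConvexAllocation.potential L w x' s' y :=
      ConvexAllocation.potential_nonneg (by linarith) hw' hx'.1 hs'
    have hgQ : g (x' q.dir) ≤ Q := by
      have h1 := h e.1 e.2
      have h2 : g (e.1 q.dir) ≤ (q.cost 1).toReal := by
        have := (ENNReal.ofReal_le_iff_le_toReal hfin).1 (hgle 1 h1mem)
        simpa [he] using this
      have h3 := mul_le_mul_of_nonneg_left h2 hK0.le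
      have h4 := hpot e.1
      rw [hQ, Configuration.potential]
      linarith
    have hcost : q.cost (p q.dir) ≤ ENNReal.ofReal (g (x' q.dir)) := by
      rw [hpr]
      refine hgk _ (hIcc x' hx' q.dir) η hη.le ?_
      rw [div_mul_cancel₀ _ hη.ne']
      linarith
    refine ⟨⟨x', s', ⟨p, hp⟩, hx', hs'⟩, hpη, fun y => ?_⟩
    have h1 := h y.1 y.2
    calc ENNReal.ofReal (ConvexAllocation.potential L w x' s' y.1)
          + ENNReal.ofReal (∑ i, w i * |x' i - C.point i|) + q.cost (p q.dir)
        ≤ ENNReal.ofReal (ConvexAllocation.potential L w x' s' y.1)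
          + ENNReal.ofReal (∑ i, w i * |x' i - C.point i|) + ENNReal.ofReal (g (x' q.dir)) := by
          gcongr
      _ = ENNReal.ofReal (ConvexAllocation.potential L w x' s' y.1
          + ∑ i, w i * |x' i - C.point i| + g (x' q.dir)) := by
          rw [ENNReal.ofReal_add (add_nonneg (hpot _) hmv) (hg0 _),
            ENNReal.ofReal_add (hpot _) hmv]
      _ ≤ ENNReal.ofReal (C.potential L w y + K * g (y.1 q.dir)) := ENNReal.ofReal_le_ofReal h1
      _ = ENNReal.ofReal (C.potential L w y) + ENNReal.ofReal K * ENNReal.ofReal (g (y.1 q.dir)) := by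
          rw [ENNReal.ofReal_add (C.potential_nonneg (by linarith) hw' y)
            (mul_nonneg hK0.le (hg0 _)), ENNReal.ofReal_mul hK0.le]
      _ ≤ _ := by gcongr; exact hgle _ (hIcc y.1 y.2 q.dir)

/-! ### Amortization over the request sequence -/

lemma totalCost_cons (w : Fin ℓ → ℝ) (q : Request ℓ) (σ : List (Request ℓ))
    (x : ℕ → stdSimplex ℝ (Fin ℓ)) :
    totalCost w (q :: σ) x
      = moveCost w (x 0) (x 1) + q.cost ((x 1).1 q.dir) + totalCost w σ fun t => x (t + 1) := by
  unfold totalCost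
  exact Fin.sum_univ_succ _

lemma totalCost_append_singleton (w : Fin ℓ → ℝ) (σ : List (Request ℓ)) (q : Request ℓ)
    (x : ℕ → stdSimplex ℝ (Fin ℓ)) :
    totalCost w (σ ++ [q]) x = totalCost w σ x
      + (moveCost w (x σ.length) (x (σ.length + 1)) + q.cost ((x (σ.length + 1)).1 q.dir)) := by
  induction σ generalizing x with
  | nil => rw [List.nil_append, totalCost_cons]; simp [totalCost]
  | cons a σ ih =>
    rw [List.cons_append, totalCost_cons, totalCost_cons, ih, List.length_cons]
    ring

lemma totalCost_congr (w : Fin ℓ → ℝ) (σ : List (Request ℓ)) {x y : ℕ → stdSimplex ℝ (Fin ℓ)}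
    (h : ∀ t ≤ σ.length, x t = y t) : totalCost w σ x = totalCost w σ y := by
  unfold totalCost
  exact Finset.sum_congr rfl fun t _ => by rw [h t t.2.le, h (t + 1) t.2]

/-- The configuration reached on a sequence of requests, the latest request first. -/
def run (step : ℕ → Configuration ℓ → Request ℓ → Configuration ℓ) (C₀ : Configuration ℓ) :
    List (Request ℓ) → Configuration ℓ
  | [] => C₀
  | q :: σ => step σ.length (run step C₀ σ) q

lemma moveCost_position_le {w : Fin ℓ → ℝ} (hw : ∀ i, 0 ≤ w i) {C C' : Configuration ℓ} {η η' : ℝ}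
    (h : ∀ i, |C.position.1 i - C.point i| ≤ η) (h' : ∀ i, |C'.position.1 i - C'.point i| ≤ η') :
    moveCost w C.position C'.position
      ≤ ENNReal.ofReal (∑ i, w i * |C'.point i - C.point i|)
        + ENNReal.ofReal ((∑ i, w i) * (η + η')) := by
  refine le_trans (ENNReal.ofReal_le_ofReal ?_) ENNReal.ofReal_add_le
  rw [Finset.sum_mul, ← Finset.sum_add_distrib]
  refine Finset.sum_le_sum fun i _ => ?_
  rw [← mul_add]
  refine mul_le_mul_of_nonneg_left ?_ (hw i)
  have h1 := abs_le.1 (h i)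
  have h2 := abs_le.1 (h' i)
  have h3 := abs_le.1 (le_refl |C'.point i - C.point i|)
  exact abs_le.2 ⟨by linarith, by linarith⟩

/-- Amortized analysis: online costs plus final potential are bounded by offline costs plus initial
potential. -/
lemma potential_add_totalCost_le {L K : ℝ} {w : Fin ℓ → ℝ} (hw : ∀ i, 0 ≤ w i) (hL : 1 ≤ L)
    (hK : 16 * L ≤ K) {step : ℕ → Configuration ℓ → Request ℓ → Configuration ℓ}
    (hstep : ∀ t C q, Serves L K w ((1 / 2) ^ (t + 1)) C q (step t C q)) {C₀ : Configuration ℓ}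
    (hC₀ : C₀.position.1 = C₀.point) (σ : List (Request ℓ)) (y : ℕ → stdSimplex ℝ (Fin ℓ)) :
    ENNReal.ofReal ((run step C₀ σ.reverse).potential L w (y σ.length))
        + totalCost w σ (fun t => (run step C₀ (σ.take t).reverse).position)
        + ENNReal.ofReal ((∑ i, w i) * (3 * (1 / 2) ^ σ.length))
      ≤ ENNReal.ofReal (C₀.potential L w (y 0)) + ENNReal.ofReal K * totalCost w σ y
        + ENNReal.ofReal ((∑ i, w i) * 3) := by
  have hW : 0 ≤ ∑ i, w i := Finset.sum_nonneg fun i _ => hw i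
  induction σ using List.reverseRecOn with
  | nil => simp [totalCost, run]
  | append_singleton σ q ih =>
    -- After `n ≥ 1` requests the last step was number `n - 1`, with accuracy `(1 / 2) ^ n`;
    -- initially position and point coincide.
    have hclose : ∀ i, |(run step C₀ σ.reverse).position.1 i - (run step C₀ σ.reverse).point i|
        ≤ (1 / 2) ^ σ.length := by
      rcases List.eq_nil_or_concat σ with rfl | ⟨τ, a, rfl⟩
      · intro i; simp [run, hC₀]
      · intro i
        have := (hstep τ.length (run step C₀ τ.reverse) a).1 i
        simpa [run] using this
    set C := run step C₀ σ.reverse with hC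
    set n := σ.length with hn
    have hC' : run step C₀ (σ ++ [q]).reverse = step n C q := by simp [run, hC, hn]
    obtain ⟨hpos, hserve⟩ := hstep n C q
    have hlen : (σ ++ [q]).length = n + 1 := by simp [hn]
    have hcongr : totalCost w σ (fun t => (run step C₀ ((σ ++ [q]).take t).reverse).position)
        = totalCost w σ (fun t => (run step C₀ (σ.take t).reverse).position) :=
      totalCost_congr w σ fun t ht => by simp only [List.take_append_of_le_length ht]
    have htake : ((σ ++ [q]).take n).reverse = σ.reverse := by
      rw [hn, List.take_left']; rfl
    have htake' : ((σ ++ [q]).take (n + 1)).reverse = (σ ++ [q]).reverse := by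
      rw [← hlen, List.take_length]
    rw [totalCost_append_singleton, totalCost_append_singleton, hcongr, ← hn, htake, htake', hC',
      hlen, ← hC]
    have hmove := moveCost_position_le hw hclose hpos
    have hoff : ENNReal.ofReal (C.potential L w (y (n + 1)))
        ≤ ENNReal.ofReal (C.potential L w (y n))
          + ENNReal.ofReal K * moveCost w (y n) (y (n + 1)) := by
      have hm : 0 ≤ ∑ i, w i * |(y (n + 1)).1 i - (y n).1 i| :=
        Finset.sum_nonneg fun i _ => mul_nonneg (hw i) (abs_nonneg _)
      rw [moveCost, ← ENNReal.ofReal_mul (by linarith)]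
      refine le_trans (ENNReal.ofReal_le_ofReal ?_) ENNReal.ofReal_add_le
      refine (potential_le_add hL hw _ _ (y n).1 (y (n + 1)).1).trans ?_
      exact add_le_add_right (mul_le_mul_of_nonneg_right hK hm) _
    -- The reserve `3 * (1 / 2) ^ n` loses exactly the sum of two consecutive shift errors in each
    -- step.
    have herr : ENNReal.ofReal ((∑ i, w i) * ((1 / 2) ^ n + (1 / 2) ^ (n + 1)))
        + ENNReal.ofReal ((∑ i, w i) * (3 * (1 / 2) ^ (n + 1)))
        = ENNReal.ofReal ((∑ i, w i) * (3 * (1 / 2) ^ n)) := by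
      rw [← ENNReal.ofReal_add (by positivity) (by positivity)]
      congr 1
      rw [pow_succ]; ring
    set T := totalCost w σ fun t => (run step C₀ (σ.take t).reverse).position
    set C' := step n C q
    calc ENNReal.ofReal (C'.potential L w (y (n + 1)))
          + (T + (moveCost w C.position C'.position + q.cost (C'.position.1 q.dir)))
          + ENNReal.ofReal ((∑ i, w i) * (3 * (1 / 2) ^ (n + 1)))
        ≤ ENNReal.ofReal (C'.potential L w (y (n + 1)))
          + (T + ((ENNReal.ofReal (∑ i, w i * |C'.point i - C.point i|)
            + ENNReal.ofReal ((∑ i, w i) * ((1 / 2) ^ n + (1 / 2) ^ (n + 1))))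
            + q.cost (C'.position.1 q.dir)))
          + ENNReal.ofReal ((∑ i, w i) * (3 * (1 / 2) ^ (n + 1))) := by gcongr
      _ = (ENNReal.ofReal (C'.potential L w (y (n + 1)))
          + ENNReal.ofReal (∑ i, w i * |C'.point i - C.point i|) + q.cost (C'.position.1 q.dir))
          + T + (ENNReal.ofReal ((∑ i, w i) * ((1 / 2) ^ n + (1 / 2) ^ (n + 1)))
          + ENNReal.ofReal ((∑ i, w i) * (3 * (1 / 2) ^ (n + 1)))) := by ring
      _ ≤ (ENNReal.ofReal (C.potential L w (y n))
          + ENNReal.ofReal K * moveCost w (y n) (y (n + 1))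
          + ENNReal.ofReal K * q.cost ((y (n + 1)).1 q.dir))
          + T + ENNReal.ofReal ((∑ i, w i) * (3 * (1 / 2) ^ n)) := by
        rw [herr]
        gcongr ?_ + T + _
        exact (hserve (y (n + 1))).trans (by gcongr)
      _ = (ENNReal.ofReal (C.potential L w (y n)) + T
          + ENNReal.ofReal ((∑ i, w i) * (3 * (1 / 2) ^ n)))
          + ENNReal.ofReal K * (moveCost w (y n) (y (n + 1))
            + q.cost ((y (n + 1)).1 q.dir)) := by ring
      _ ≤ _ := by
        refine (add_le_add_left ih _).trans_eq ?_
        ring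

end ConvexAllocation

end

/-! ### Choice of constants -/

theorem theorem4 :
    ∃ K : NNReal, ∀ (ℓ : ℕ), 2 ≤ ℓ → ∀ w : Fin ℓ → ℝ, (∀ i, 0 < w i) →
      ∃ B : NNReal, ∀ x₀ : stdSimplex ℝ (Fin ℓ),
        ∃ A : ConvexAllocation.OnlineAlgorithm ℓ,
          A [] = x₀ ∧
            ConvexAllocation.IsCompetitive w A (K * (Real.log (ℓ : ℝ)).toNNReal) B := by
  open ConvexAllocation in
  -- From `L ≤ 6 log ℓ` and `1 ≤ 2 log ℓ`, `32 L + 28 ≤ (32 * 6 + 28 * 2) log ℓ`. The factor 15 is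
  -- 12 for the initial potential plus 3 for the shift errors.
  refine ⟨248, fun ℓ hℓ w hw => ⟨Real.toNNReal (15 * ∑ i, w i), fun x₀ => ?_⟩⟩
  have hw' : ∀ i, 0 ≤ w i := fun i => (hw i).le
  have hW : 0 ≤ ∑ i, w i := Finset.sum_nonneg fun i _ => hw' i
  have hℓ' : (2 : ℝ) ≤ ℓ := by exact_mod_cast hℓ
  have hlog : 1 / 2 ≤ Real.log ℓ := by
    have := Real.log_two_gt_d9
    have := Real.log_le_log two_pos hℓ'
    linarith
  obtain ⟨L, hL⟩ : ∃ L, L = Real.log (18 * ℓ) := ⟨_, rfl⟩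
  have hexp : Real.exp L = 18 * ℓ := by rw [hL, Real.exp_log (by positivity)]
  have hL3 : 3 ≤ L := by
    rw [hL, Real.le_log_iff_exp_le (by positivity)]
    have h1 := Real.exp_one_lt_d9
    have h2 : Real.exp 3 = Real.exp 1 ^ 3 := by rw [← Real.exp_nat_mul]; norm_num
    have h3 : Real.exp 1 ^ 3 ≤ 3 ^ 3 := by gcongr; linarith
    norm_num at h3
    linarith
  have hLle : L ≤ 6 * Real.log ℓ := by
    have : (18 : ℝ) * ℓ ≤ (ℓ : ℝ) ^ 6 := by
      have h1 : (2 : ℝ) ^ 5 ≤ (ℓ : ℝ) ^ 5 := by gcongr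
      have h2 := mul_le_mul_of_nonneg_right h1 (by linarith : (0 : ℝ) ≤ ℓ)
      have h3 : (ℓ : ℝ) ^ 6 = (ℓ : ℝ) ^ 5 * ℓ := by ring
      rw [h3]; linarith
    have h2 := Real.log_le_log (by positivity) this
    rw [Real.log_pow] at h2
    rw [hL]; exact_mod_cast h2
  have hK : 32 * L + 28 ≤ 248 * Real.log ℓ := by linarith
  choose step hstep using fun t : ℕ =>
    exists_serves hw hexp hL3 hK (η := (1 / 2) ^ (t + 1)) (by positivity)
  let C₀ : Configuration ℓ := ⟨x₀.1, x₀.1, x₀, x₀.2, fun _ => le_rfl⟩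
  refine ⟨fun σ => (run step C₀ σ.reverse).position, rfl, fun σ => ?_⟩
  have hx₀ : C₀.potential L w x₀ ≤ 12 * ∑ i, w i := by
    have h1 : ∑ i, w i * x₀.1 i ≤ ∑ i, w i := by
      refine Finset.sum_le_sum fun i _ => mul_le_of_le_one_right (hw' i) ?_
      exact x₀.2.2 ▸ Finset.single_le_sum (fun i _ => x₀.2.1 i) (Finset.mem_univ i)
    simp only [Configuration.potential, C₀, potential, sub_self,
      clampedEntropy_zero (by linarith : 0 ≤ L)]
    simp only [zero_div, add_zero, mul_zero, Finset.sum_const_zero, zero_add]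
    linarith
  have hρ : ((248 * (Real.log (ℓ : ℝ)).toNNReal : NNReal) : ENNReal)
      = ENNReal.ofReal (248 * Real.log ℓ) := by
    rw [ENNReal.ofReal_mul (by norm_num), ENNReal.coe_mul]
    simp [ENNReal.ofReal]
  have hB : ((Real.toNNReal (15 * ∑ i, w i) : NNReal) : ENNReal)
      = ENNReal.ofReal (12 * ∑ i, w i) + ENNReal.ofReal ((∑ i, w i) * 3) := by
    rw [← ENNReal.ofReal_add (by positivity) (by positivity), ENNReal.ofReal]
    congr 2; ring
  have key : ∀ y : ℕ → stdSimplex ℝ (Fin ℓ), y 0 = x₀ →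
      onlineCost w (fun σ => (run step C₀ σ.reverse).position) σ
        ≤ ENNReal.ofReal (248 * Real.log ℓ) * totalCost w σ y
          + (ENNReal.ofReal (12 * ∑ i, w i) + ENNReal.ofReal ((∑ i, w i) * 3)) := by
    intro y hy
    have h := potential_add_totalCost_le hw' (by linarith) (by linarith) hstep (C₀ := C₀) rfl σ y
    rw [hy] at h
    calc onlineCost w (fun σ => (run step C₀ σ.reverse).position) σ
        ≤ _ := (le_add_self.trans le_self_add).trans h
      _ ≤ ENNReal.ofReal (12 * ∑ i, w i) + ENNReal.ofReal (248 * Real.log ℓ) * totalCost w σ y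
        + ENNReal.ofReal ((∑ i, w i) * 3) := by gcongr
      _ = _ := by ring
  rw [hρ, hB, offlineCost]
  have hne : ENNReal.ofReal (248 * Real.log ℓ) ≠ 0 := by
    rw [Ne, ENNReal.ofReal_eq_zero]; linarith
  rw [ENNReal.mul_iInf_of_ne hne ENNReal.ofReal_ne_top, ENNReal.iInf_add]
  refine le_iInf fun y => ?_
  rw [ENNReal.mul_iInf_of_ne hne ENNReal.ofReal_ne_top, ENNReal.iInf_add]
  exact le_iInf fun hy => key y hy
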